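/- Let $d\ge 1$ and let $\Omega\subset\mathbb R^d$ be a bounded open set. Let $A:\Omega\to\mathbb R^{d\times d}$ be measurable and symmetric with $|\xi|^2\le A(x)\xi\cdot\xi\le a_{\max}|\xi|^2$ for almost all $x\in\Omega$ and all $\xi\in\mathbb R^d$, for some constant $a_{\max}$. Let $\mathbf b\in L^\infty(\Omega)^d$ and $c\in L^\infty(\Omega)$, and let $c=c^++c^-$ with $c^+\in L^\infty(\Omega)$ and $c^+\ge 0$ almost everywhere. Put $$c^-_{\inf}=\operatorname*{ess\,inf}_{\Omega}c^-,\qquad C_0(\mathbf b,c^-)=\Big(\tfrac12\|\mathbf b\|_\infty^2+\max\{-c^-_{\inf},0\}\Big)^{1/2},$$ where $\|\mathbf b\|_\infty$ is the essential supremum over $\Omega$ of the Euclidean norm $|\mathbf b(x)|$. For an open set $\Omega'\subseteq\Omega$ and $u,v\in H^1(\Omega')$ put $$b_{\Omega'}(u,v)=\int_{\Omega'}\big(A\nabla u\cdot\nabla v+\mathbf b\cdot\nabla u\,v+c\,u\,v\big)\,dx,\qquad b:=b_\Omega .$$ Let $V^h\subset H^1_0(\Omega)$ be a finite-dimensional subspace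 (for instance, any conforming finite element space). Let $\Omega_1,\dots,\Omega_N\subseteq\Omega$ be open sets (for instance, the overlapping subdomains of a domain decomposition of $\Omega$), and let $H=\max_i\operatorname{diam}\Omega_i$. Let $$V_i=\{v|_{\Omega_i}:\ v\in V^h,\ v|_{\Omega_i}\in H^1_0(\Omega_i)\},$$ and let $R_i^\top v\in H^1_0(\Omega)$ denote the extension by zero of $v\in V_i$ to $\Omega$. (a) If $H\,C_0(\mathbf b,c^-)<\tfrac12$, then for each $i=1,\dots,N$ the operator $T_i:V^h\to V_i$ given by $$b_{\Omega_i}(T_iu,v)=b(u,R_i^\top v)\qquad\text{for all }v\in V_i$$ is well-defined: for every $u\in V^h$ there is exactly one $T_iu\in V_i$ with this property, and $u\mapsto T_iu$ is linear (and is the only linear map $V^h\to V_i$ satisfying these equations). (b) If $c^-_{\inf}\ge 0$ and $\mathbf b=\mathbf 0$ almost everywhere in $\Omega$, then the conclusion of (a) holds for each $i$ without any condition on $H$. -/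

import Mathlib

open MeasureTheory
open scoped ENNReal ContDiff InnerProductSpace

namespace Schwarz

/-- Euclidean space `ℝ^d`. -/
abbrev Space (d : ℕ) := EuclideanSpace ℝ (Fin d)

/-- `φ ∈ C_c^∞(Ω)`: `φ` is smooth and its support is a compact subset of `Ω`. -/
structure IsTestFunction {d : ℕ} (Ω : Set (Space d)) (φ : Space d → ℝ) : Prop where
  smooth : ContDiff ℝ ∞ φ
  compactSupport : HasCompactSupport φ
  support_subset : tsupport φ ⊆ Ω

/-- The space `L²(Ω; F)`. -/
noncomputable abbrev L2 {d : ℕ} (Ω : Set (Space d)) (F : Type) [NormedAddCommGroup F] :=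
  Lp F 2 (volume.restrict Ω)

/-- Pairs `(u, g)` in `L²(Ω) × L²(Ω; ℝ^d)`. A function `u ∈ H¹(Ω)` is recorded as the pair `(u, ∇u)`
(the second component is determined by the first one, see `H1_grad_unique`), so that the topology of
the product is that of the `H¹` norm. -/
noncomputable abbrev SobolevPair {d : ℕ} (Ω : Set (Space d)) := L2 Ω ℝ × L2 Ω (Space d)

section TestFunctions

variable {d : ℕ} {Ω : Set (Space d)} {φ : Space d → ℝ}

lemma IsTestFunction.continuous_gradient (h : IsTestFunction Ω φ) :
    Continuous (fun x => gradient φ x) :=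
  (InnerProductSpace.toDual ℝ (Space d)).symm.continuous.comp
    (h.smooth.continuous_fderiv (by simp))

lemma IsTestFunction.gradient_compactSupport (h : IsTestFunction Ω φ) :
    HasCompactSupport (fun x => gradient φ x) :=
  (h.compactSupport.fderiv (𝕜 := ℝ)).comp_left (map_zero _)

lemma IsTestFunction.memLp (h : IsTestFunction Ω φ) (s : Set (Space d)) :
    MemLp φ 2 (volume.restrict s) :=
  (h.smooth.continuous.memLp_of_hasCompactSupport h.compactSupport).mono_measure
    Measure.restrict_le_self

lemma IsTestFunction.memLp_gradient (h : IsTestFunction Ω φ) (s : Set (Space d)) :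
    MemLp (fun x => gradient φ x) 2 (volume.restrict s) :=
  (h.continuous_gradient.memLp_of_hasCompactSupport h.gradient_compactSupport).mono_measure
    Measure.restrict_le_self

lemma integrable_smul_of_L2 {F : Type} [NormedAddCommGroup F] [NormedSpace ℝ F]
    {μ : Measure (Space d)} {f : Space d → ℝ} {g : Space d → F}
    (hf : MemLp f 2 μ) (hg : MemLp g 2 μ) : Integrable (fun x => f x • g x) μ := by
  have := MemLp.smul (p := 2) (q := 2) (r := 1) hg hf
  exact memLp_one_iff_integrable.1 this

end TestFunctions

/-- The Sobolev space `H¹(Ω)`: all `(u, g)` with `u ∈ L²(Ω)` and with `g ∈ L²(Ω; ℝ^d)` the weak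
gradient of `u`, that is, `∫_Ω u ∇φ = - ∫_Ω φ g` for all test functions `φ`. -/
noncomputable def H1 {d : ℕ} (Ω : Set (Space d)) : Submodule ℝ (SobolevPair Ω) where
  carrier := {p | ∀ φ : Space d → ℝ, IsTestFunction Ω φ →
    ∫ x in Ω, p.1 x • gradient φ x = - ∫ x in Ω, φ x • p.2 x}
  zero_mem' := by
    intro φ _
    have h1 : ∫ x in Ω, ((0 : SobolevPair Ω).1 x) • gradient φ x = ∫ x in Ω, (0 : Space d) := by
      refine integral_congr_ae ?_
      filter_upwards [Lp.coeFn_zero ℝ 2 (volume.restrict Ω)] with x hx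
      rw [Prod.fst_zero, hx, Pi.zero_apply, zero_smul]
    have h2 : ∫ x in Ω, φ x • ((0 : SobolevPair Ω).2 x) = ∫ x in Ω, (0 : Space d) := by
      refine integral_congr_ae ?_
      filter_upwards [Lp.coeFn_zero (Space d) 2 (volume.restrict Ω)] with x hx
      rw [Prod.snd_zero, hx, Pi.zero_apply, smul_zero]
    rw [h1, h2]
    simp
  add_mem' := by
    intro p q hp hq φ hφ
    have h1 : ∫ x in Ω, (p + q).1 x • gradient φ x
        = ∫ x in Ω, (p.1 x • gradient φ x + q.1 x • gradient φ x) := by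
      refine integral_congr_ae ?_
      filter_upwards [Lp.coeFn_add p.1 q.1] with x hx
      rw [Prod.fst_add, hx, Pi.add_apply, add_smul]
    have h2 : ∫ x in Ω, φ x • (p + q).2 x = ∫ x in Ω, (φ x • p.2 x + φ x • q.2 x) := by
      refine integral_congr_ae ?_
      filter_upwards [Lp.coeFn_add p.2 q.2] with x hx
      rw [Prod.snd_add, hx, Pi.add_apply, smul_add]
    rw [h1, h2, integral_add, integral_add, hp φ hφ, hq φ hφ, neg_add]
    · exact integrable_smul_of_L2 (hφ.memLp Ω) (Lp.memLp p.2)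
    · exact integrable_smul_of_L2 (hφ.memLp Ω) (Lp.memLp q.2)
    · exact integrable_smul_of_L2 (Lp.memLp p.1) (hφ.memLp_gradient Ω)
    · exact integrable_smul_of_L2 (Lp.memLp q.1) (hφ.memLp_gradient Ω)
  smul_mem' := by
    intro r p hp φ hφ
    have h1 : ∫ x in Ω, (r • p).1 x • gradient φ x = ∫ x in Ω, r • (p.1 x • gradient φ x) := by
      refine integral_congr_ae ?_
      filter_upwards [Lp.coeFn_smul r p.1] with x hx
      simp [hx, mul_smul]
    have h2 : ∫ x in Ω, φ x • (r • p).2 x = ∫ x in Ω, r • (φ x • p.2 x) := by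
      refine integral_congr_ae ?_
      filter_upwards [Lp.coeFn_smul r p.2] with x hx
      simp [hx, smul_comm r]
    rw [h1, h2, integral_smul, integral_smul, hp φ hφ, smul_neg]

/-- The pairs `(φ, ∇φ)` for `φ ∈ C_c^∞(Ω)`. -/
def testPairs {d : ℕ} (Ω : Set (Space d)) : Set (SobolevPair Ω) :=
  {p | ∃ φ : Space d → ℝ, IsTestFunction Ω φ ∧
    p.1 =ᵐ[volume.restrict Ω] φ ∧ p.2 =ᵐ[volume.restrict Ω] fun x => gradient φ x}

/-- The Sobolev space `H¹₀(Ω)`: the closure of `C_c^∞(Ω)` in the `H¹` norm. It is contained in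
`H¹(Ω)`, see `H10_le_H1`. -/
noncomputable def H10 {d : ℕ} (Ω : Set (Space d)) : Submodule ℝ (SobolevPair Ω) :=
  (Submodule.span ℝ (testPairs Ω)).topologicalClosure

section Operators

variable {d : ℕ} {Ω Ω' : Set (Space d)} {F : Type} [NormedAddCommGroup F]

/-- Restriction `L²(Ω; F) → L²(Ω'; F)`, `f ↦ f|_{Ω'}`, for `Ω' ⊆ Ω`. -/
noncomputable def restrictL2 [NormedSpace ℝ F] (h : Ω' ⊆ Ω) : L2 Ω F →ₗ[ℝ] L2 Ω' F where
  toFun f := ((Lp.memLp f).mono_measure (Measure.restrict_mono_set volume h)).toLp f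
  map_add' f g := by
    rw [← MemLp.toLp_add, MemLp.toLp_eq_toLp_iff]
    exact ae_mono (Measure.restrict_mono_set volume h) (Lp.coeFn_add f g)
  map_smul' r f := by
    rw [RingHom.id_apply, ← MemLp.toLp_const_smul, MemLp.toLp_eq_toLp_iff]
    exact ae_mono (Measure.restrict_mono_set volume h) (Lp.coeFn_smul r f)

/-- Restriction of `u` (and of its gradient) from `Ω` to `Ω' ⊆ Ω`. -/
noncomputable def restrict (h : Ω' ⊆ Ω) : SobolevPair Ω →ₗ[ℝ] SobolevPair Ω' :=
  (restrictL2 h).prodMap (restrictL2 h)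

lemma eLpNorm_indicator_le (h : MeasurableSet Ω') (f : Space d → F) :
    eLpNorm (Ω'.indicator f) 2 (volume.restrict Ω) ≤ eLpNorm f 2 (volume.restrict Ω') := by
  rw [eLpNorm_indicator_eq_eLpNorm_restrict h, Measure.restrict_restrict h]
  exact eLpNorm_mono_measure _ (Measure.restrict_mono_set volume Set.inter_subset_left)

lemma memLp_zeroExt (h : MeasurableSet Ω') {f : Space d → F}
    (hf : MemLp f 2 (volume.restrict Ω')) :
    MemLp (Ω'.indicator f) 2 (volume.restrict Ω) := by
  rw [memLp_indicator_iff_restrict h, Measure.restrict_restrict h]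
  exact hf.mono_measure (Measure.restrict_mono_set volume Set.inter_subset_left)

lemma indicator_ae_eq (h : MeasurableSet Ω') {f g : Space d → F}
    (hfg : f =ᵐ[volume.restrict Ω'] g) :
    Ω'.indicator f =ᵐ[volume.restrict Ω] Ω'.indicator g := by
  refine ae_mono Measure.restrict_le_self ?_
  filter_upwards [(ae_restrict_iff' h).1 hfg] with x hx
  by_cases hxm : x ∈ Ω'
  · simp [hxm, hx hxm]
  · simp [hxm]

variable (Ω) in
/-- Extension by zero, `L²(Ω'; F) → L²(Ω; F)`. -/
noncomputable def zeroExtL2 [NormedSpace ℝ F] (h : MeasurableSet Ω') : L2 Ω' F →L[ℝ] L2 Ω F :=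
  LinearMap.mkContinuous
    { toFun := fun f => (memLp_zeroExt h (Lp.memLp f)).toLp (Ω'.indicator f)
      map_add' := fun f g => by
        rw [← MemLp.toLp_add, MemLp.toLp_eq_toLp_iff, ← Set.indicator_add']
        exact indicator_ae_eq h (Lp.coeFn_add f g)
      map_smul' := fun r f => by
        rw [RingHom.id_apply, ← MemLp.toLp_const_smul, MemLp.toLp_eq_toLp_iff]
        refine (indicator_ae_eq h (Lp.coeFn_smul r f)).trans ?_
        exact Filter.EventuallyEq.of_eq (Set.indicator_const_smul Ω' r f) } 1
    (fun f => by
      rw [one_mul, LinearMap.coe_mk, AddHom.coe_mk, Lp.norm_toLp, Lp.norm_def]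
      exact ENNReal.toReal_mono (Lp.eLpNorm_ne_top f) (eLpNorm_indicator_le h f))

variable (Ω) in
/-- The extension operator `R^⊤`: extension by zero of `u` (and of its gradient) from `Ω'` to `Ω`.
It maps `H¹₀(Ω')` into `H¹₀(Ω)`, see `zeroExt_mem_H10`. -/
noncomputable def zeroExt (h : MeasurableSet Ω') : SobolevPair Ω' →L[ℝ] SobolevPair Ω :=
  (zeroExtL2 Ω h).prodMap (zeroExtL2 Ω h)

lemma coeFn_zeroExtL2 [NormedSpace ℝ F] (h : MeasurableSet Ω') (f : L2 Ω' F) :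
    zeroExtL2 Ω h f =ᵐ[volume.restrict Ω] Ω'.indicator f :=
  MemLp.coeFn_toLp (memLp_zeroExt h (Lp.memLp f))

end Operators

/-- The bilinear form `∫_Ω (A ∇u · ∇v + (β · ∇u) v + c u v) dx`. With a subdomain in place of `Ω` it
is the local bilinear form of that subdomain. -/
noncomputable def bForm {d : ℕ} (Ω : Set (Space d)) (A : Space d → Matrix (Fin d) (Fin d) ℝ)
    (β : Space d → Space d) (c : Space d → ℝ) (u v : SobolevPair Ω) : ℝ :=
  ∫ x in Ω, (⟪(A x).toEuclideanLin (u.2 x), v.2 x⟫_ℝ + ⟪β x, u.2 x⟫_ℝ * v.1 x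
    + c x * u.1 x * v.1 x)

/-- The local space `V_i = {v|_{Ω'} : v ∈ V^h, v|_{Ω'} = 0 on ∂Ω'}`, where vanishing on the boundary
means membership in `H¹₀(Ω')`. -/
noncomputable def localSpace {d : ℕ} {Ω Ω' : Set (Space d)} (h : Ω' ⊆ Ω)
    (Vh : Submodule ℝ (SobolevPair Ω)) : Submodule ℝ (SobolevPair Ω') :=
  Vh.map (restrict h) ⊓ H10 Ω'

/-- `c⁻_inf`, the essential infimum of `c⁻ = c - c⁺` over `Ω`. -/
noncomputable def cMinusInf {d : ℕ} (Ω : Set (Space d)) (c cplus : Space d → ℝ) : ℝ :=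
  essInf (fun x => c x - cplus x) (volume.restrict Ω)

/-- `‖β‖_∞`, the essential supremum over `Ω` of the Euclidean length of `β`. -/
noncomputable def supNorm {d : ℕ} (Ω : Set (Space d)) (β : Space d → Space d) : ℝ :=
  (eLpNorm β ∞ (volume.restrict Ω)).toReal

/-- `C₀(β, c⁻) = (‖β‖_∞² / 2 + max {-c⁻_inf, 0})^{1/2}`. -/
noncomputable def C0 {d : ℕ} (Ω : Set (Space d)) (β : Space d → Space d)
    (c cplus : Space d → ℝ) : ℝ :=
  √(1 / 2 * supNorm Ω β ^ 2 + max (-cMinusInf Ω c cplus) 0)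

/-- The operator `T : V^h → V_i` with `b_{Ω'}(T u, v) = b(u, R^⊤ v)` for all `v ∈ V_i` is
well-defined: for every `u ∈ V^h` the local problem has exactly one solution in `V_i`, and the
solution operator is a linear map, the only one that satisfies these equations. -/
def WellDefinedLocalSolve {d : ℕ} {Ω Ω' : Set (Space d)} (h : Ω' ⊆ Ω) (hm : MeasurableSet Ω')
    (A : Space d → Matrix (Fin d) (Fin d) ℝ) (β : Space d → Space d) (c : Space d → ℝ)
    (Vh : Submodule ℝ (SobolevPair Ω)) : Prop :=
  (∀ u ∈ Vh, ∃! φ : SobolevPair Ω', φ ∈ localSpace h Vh ∧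
      ∀ v ∈ localSpace h Vh, bForm Ω' A β c φ v = bForm Ω A β c u (zeroExt Ω hm v)) ∧
  ∃! T : Vh →ₗ[ℝ] localSpace h Vh, ∀ (u : Vh) (v : localSpace h Vh),
      bForm Ω' A β c (T u) v = bForm Ω A β c u (zeroExt Ω hm v)

section Facts

variable {d : ℕ} {Ω Ω' : Set (Space d)}

/-- The weak gradient is unique. -/
lemma H1_grad_unique (hΩ : IsOpen Ω) {u : L2 Ω ℝ} {g g' : L2 Ω (Space d)}
    (hg : (u, g) ∈ H1 Ω) (hg' : (u, g') ∈ H1 Ω) : g = g' := by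
  have key : ∀ᵐ x ∂(volume : Measure (Space d)), x ∈ Ω → (g x - g' x) = 0 := by
    refine hΩ.ae_eq_zero_of_integral_contDiff_smul_eq_zero (f := fun x => g x - g' x) ?_ ?_
    · have h1 : LocallyIntegrableOn (fun x => g x) Ω volume := by
        rw [locallyIntegrableOn_iff hΩ.isLocallyClosed]
        intro K hK hKc
        have : IsFiniteMeasure (volume.restrict K : Measure (Space d)) :=
          ⟨by simpa using hKc.measure_lt_top⟩
        exact ((Lp.memLp g).mono_measure (Measure.restrict_mono_set volume hK)).integrable
          (by norm_num)
      have h2 : LocallyIntegrableOn (fun x => g' x) Ω volume := by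
        rw [locallyIntegrableOn_iff hΩ.isLocallyClosed]
        intro K hK hKc
        have : IsFiniteMeasure (volume.restrict K : Measure (Space d)) :=
          ⟨by simpa using hKc.measure_lt_top⟩
        exact ((Lp.memLp g').mono_measure (Measure.restrict_mono_set volume hK)).integrable
          (by norm_num)
      exact h1.sub h2
    · intro φ hφ hφc hφs
      have hT : IsTestFunction Ω φ := ⟨hφ, hφc, hφs⟩
      have e1 := hg φ hT
      have e2 := hg' φ hT
      have e3 : ∫ x in Ω, φ x • g x = ∫ x in Ω, φ x • g' x := neg_injective (e1.symm.trans e2)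
      have e4 : ∫ x in Ω, φ x • (g x - g' x) = 0 := by
        simp_rw [smul_sub]
        rw [integral_sub (integrable_smul_of_L2 (hT.memLp Ω) (Lp.memLp g))
          (integrable_smul_of_L2 (hT.memLp Ω) (Lp.memLp g')), e3, sub_self]
      rw [← e4, setIntegral_eq_integral_of_forall_compl_eq_zero]
      intro x hx
      rw [image_eq_zero_of_notMem_tsupport (fun hx' => hx (hφs hx')), zero_smul]
  refine Lp.ext ?_
  rw [Filter.EventuallyEq, ae_restrict_iff' hΩ.measurableSet]
  filter_upwards [key] with x hx hxm
  exact sub_eq_zero.1 (hx hxm)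

lemma IsTestFunction.mono (h : Ω' ⊆ Ω) {φ : Space d → ℝ} (hφ : IsTestFunction Ω' φ) :
    IsTestFunction Ω φ :=
  ⟨hφ.smooth, hφ.compactSupport, hφ.support_subset.trans h⟩

/-- Extension by zero maps `H¹₀(Ω')` into `H¹₀(Ω)`. -/
lemma zeroExt_mem_H10 (h : Ω' ⊆ Ω) (hm : MeasurableSet Ω') {u : SobolevPair Ω'}
    (hu : u ∈ H10 Ω') : zeroExt Ω hm u ∈ H10 Ω := by
  have hmaps : ∀ p ∈ testPairs Ω', zeroExt Ω hm p ∈ testPairs Ω := by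
    rintro p ⟨φ, hφ, h1, h2⟩
    refine ⟨φ, hφ.mono h, ?_, ?_⟩
    · refine (coeFn_zeroExtL2 hm p.1).trans ((indicator_ae_eq hm h1).trans ?_)
      refine Filter.EventuallyEq.of_eq (Set.indicator_eq_self.2 fun x hx => ?_)
      exact hφ.support_subset (subset_tsupport _ hx)
    · refine (coeFn_zeroExtL2 hm p.2).trans ((indicator_ae_eq hm h2).trans ?_)
      refine Filter.EventuallyEq.of_eq (Set.indicator_eq_self.2 fun x hx => ?_)
      refine hφ.support_subset (tsupport_fderiv_subset ℝ (subset_tsupport _ fun h0 => hx ?_))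
      simp only [gradient, h0, map_zero]
  have hspan : Set.MapsTo (zeroExt Ω hm) (Submodule.span ℝ (testPairs Ω'))
      (Submodule.span ℝ (testPairs Ω)) := by
    intro p hp
    induction hp using Submodule.span_induction with
    | mem p hp => exact Submodule.subset_span (hmaps p hp)
    | zero => rw [map_zero]; exact Submodule.zero_mem _
    | add p q _ _ ihp ihq => rw [map_add]; exact Submodule.add_mem _ ihp ihq
    | smul r p _ ih => rw [map_smul]; exact Submodule.smul_mem _ r ih
  exact map_mem_closure (zeroExt Ω hm).continuous hu hspan

lemma inner_gradient_eq (φ : Space d → ℝ) (x e : Space d) :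
    ⟪e, gradient φ x⟫_ℝ = fderiv ℝ φ x e := by
  rw [real_inner_comm, gradient, InnerProductSpace.toDual_symm_apply]

lemma IsTestFunction.integral_by_parts {φ ψ : Space d → ℝ}
    (hφ : IsTestFunction Ω φ) (hψ : IsTestFunction Ω ψ) :
    ∫ x in Ω, φ x • gradient ψ x = - ∫ x in Ω, ψ x • gradient φ x := by
  rw [setIntegral_eq_integral_of_forall_compl_eq_zero,
    setIntegral_eq_integral_of_forall_compl_eq_zero]
  rotate_left
  · intro x hx
    rw [image_eq_zero_of_notMem_tsupport (fun hx' => hx (hψ.support_subset hx')), zero_smul]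
  · intro x hx
    rw [image_eq_zero_of_notMem_tsupport (fun hx' => hx (hφ.support_subset hx')), zero_smul]
  have aux : ∀ {f g : Space d → ℝ}, IsTestFunction Ω f → IsTestFunction Ω g →
      Integrable (fun x => f x • gradient g x) := fun hf hg => by
    have := integrable_smul_of_L2 (hf.memLp Set.univ) (hg.memLp_gradient Set.univ)
    rwa [Measure.restrict_univ] at this
  refine ext_inner_left ℝ fun e => ?_
  rw [inner_neg_right, ← integral_inner (aux hφ hψ), ← integral_inner (aux hψ hφ)]
  simp only [inner_smul_right, inner_gradient_eq]
  have i1 : Integrable (fun x => φ x * fderiv ℝ ψ x e) := by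
    simpa only [inner_smul_right, inner_gradient_eq] using (aux hφ hψ).const_inner (𝕜 := ℝ) e
  have i2 : Integrable (fun x => fderiv ℝ φ x e * ψ x) := by
    simpa only [inner_smul_right, inner_gradient_eq, mul_comm] using (aux hψ hφ).const_inner (𝕜 := ℝ) e
  have i3 : Integrable (fun x => φ x * ψ x) :=
    (hφ.smooth.continuous.mul hψ.smooth.continuous).integrable_of_hasCompactSupport
      hφ.compactSupport.mul_right
  rw [integral_mul_fderiv_eq_neg_fderiv_mul_of_integrable i2 i1 i3
    (fun x _ => hφ.smooth.differentiable (by simp) x)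
    (fun x _ => hψ.smooth.differentiable (by simp) x)]
  simp only [mul_comm]

lemma IsTestFunction.memLp_smul_const {φ : Space d → ℝ} (h : IsTestFunction Ω φ)
    (s : Set (Space d)) (e : Space d) : MemLp (fun x => φ x • e) 2 (volume.restrict s) :=
  ((h.smooth.continuous.smul continuous_const).memLp_of_hasCompactSupport
    h.compactSupport.smul_right).mono_measure Measure.restrict_le_self

lemma isClosed_H1 : IsClosed (H1 Ω : Set (SobolevPair Ω)) := by
  have hset : (H1 Ω : Set (SobolevPair Ω)) = ⋂ (φ : Space d → ℝ) (hφ : IsTestFunction Ω φ)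
      (e : Space d), {p | ⟪((hφ.memLp_gradient Ω).const_inner e).toLp _, p.1⟫_ℝ
        = - ⟪(hφ.memLp_smul_const Ω e).toLp _, p.2⟫_ℝ} := by
    ext p
    simp only [Set.mem_iInter, Set.mem_ofPred_eq, SetLike.mem_coe]
    refine forall_congr' fun φ => forall_congr' fun hφ => ?_
    have e1 : ∀ e, ⟪((hφ.memLp_gradient Ω).const_inner e).toLp _, p.1⟫_ℝ
        = ⟪e, ∫ x in Ω, p.1 x • gradient φ x⟫_ℝ := fun e => by
      rw [L2.inner_def, ← integral_inner
        (integrable_smul_of_L2 (Lp.memLp p.1) (hφ.memLp_gradient Ω))]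
      refine integral_congr_ae ?_
      filter_upwards [((hφ.memLp_gradient Ω).const_inner (𝕜 := ℝ) e).coeFn_toLp] with x hx
      rw [hx, inner_smul_right]
      simp
    have e2 : ∀ e, ⟪(hφ.memLp_smul_const Ω e).toLp _, p.2⟫_ℝ
        = ⟪e, ∫ x in Ω, φ x • p.2 x⟫_ℝ := fun e => by
      rw [L2.inner_def, ← integral_inner
        (integrable_smul_of_L2 (hφ.memLp Ω) (Lp.memLp p.2))]
      refine integral_congr_ae ?_
      filter_upwards [(hφ.memLp_smul_const Ω e).coeFn_toLp] with x hx
      rw [hx, inner_smul_right, inner_smul_left]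
      simp
    simp only [e1, e2]
    exact ⟨fun h e => by rw [← inner_neg_right]; exact congrArg _ h,
      fun h => ext_inner_left ℝ fun e => by rw [inner_neg_right]; exact h e⟩
  rw [hset]
  refine isClosed_iInter fun φ => isClosed_iInter fun hφ => isClosed_iInter fun e => ?_
  exact isClosed_eq (continuous_const.inner continuous_fst)
    (continuous_const.inner continuous_snd).neg

/-- `H¹₀(Ω) ⊆ H¹(Ω)`. -/
lemma H10_le_H1 : H10 Ω ≤ H1 Ω := by
  refine Submodule.topologicalClosure_minimal _ (Submodule.span_le.2 ?_) isClosed_H1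
  rintro p ⟨φ, hφ, h1, h2⟩ ψ hψ
  have e1 : ∫ x in Ω, p.1 x • gradient ψ x = ∫ x in Ω, φ x • gradient ψ x :=
    integral_congr_ae (h1.mono fun x hx => by simp only [hx])
  have e2 : ∫ x in Ω, ψ x • p.2 x = ∫ x in Ω, ψ x • gradient φ x :=
    integral_congr_ae (h2.mono fun x hx => by simp only [hx])
  rw [e1, e2, hφ.integral_by_parts hψ]

/-- The restriction of an element of `H¹(Ω)` belongs to `H¹(Ω')`. -/
lemma restrict_mem_H1 (h : Ω' ⊆ Ω) {u : SobolevPair Ω} (hu : u ∈ H1 Ω) :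
    restrict h u ∈ H1 Ω' := by
  intro φ hφ
  have aux : ∀ f : Space d → Space d, (∀ x ∉ tsupport φ, f x = 0) →
      ∫ x in Ω', f x = ∫ x in Ω, f x := fun f hf => by
    rw [setIntegral_eq_integral_of_forall_compl_eq_zero
        (fun x hx => hf x fun hx' => hx (hφ.support_subset hx')),
      setIntegral_eq_integral_of_forall_compl_eq_zero
        (fun x hx => hf x fun hx' => hx (h (hφ.support_subset hx')))]
  have m1 : ∀ᵐ x ∂(volume.restrict Ω'), (restrict h u).1 x = u.1 x :=
    MemLp.coeFn_toLp ((Lp.memLp u.1).mono_measure (Measure.restrict_mono_set volume h))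
  have m2 : ∀ᵐ x ∂(volume.restrict Ω'), (restrict h u).2 x = u.2 x :=
    MemLp.coeFn_toLp ((Lp.memLp u.2).mono_measure (Measure.restrict_mono_set volume h))
  have e1 : ∫ x in Ω', (restrict h u).1 x • gradient φ x = ∫ x in Ω', u.1 x • gradient φ x :=
    integral_congr_ae (m1.mono fun x hx => by simp only [hx])
  have e2 : ∫ x in Ω', φ x • (restrict h u).2 x = ∫ x in Ω', φ x • u.2 x :=
    integral_congr_ae (m2.mono fun x hx => by simp only [hx])
  rw [e1, e2, aux, aux, hu φ (hφ.mono h)]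
  · intro x hx
    rw [image_eq_zero_of_notMem_tsupport hx, zero_smul]
  · intro x hx
    have : fderiv ℝ φ x = 0 :=
      image_eq_zero_of_notMem_tsupport fun hx' => hx (tsupport_fderiv_subset ℝ hx')
    rw [gradient, this, map_zero, smul_zero]

end Facts

end Schwarz

/-! Each local problem is a square linear system on the finite-dimensional space V_i, so it suffices
that b_{Ω_i} is definite on H¹₀(Ω_i): b(u,u) = 0 must force u = 0. Then u ↦ b_{Ω_i}(u,·) is an
injective map from V_i to its dual, which has the same dimension, hence an isomorphism; composing
its inverse with u ↦ b(u, R_i^⊤ ·) gives T_i, its linearity and its uniqueness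
(`wellDefinedLocalSolve_of_definite`).

Definiteness comes from two estimates. The Poincaré inequality ‖u‖ ≤ diam(Ω_i) ‖∇u‖ on H¹₀(Ω_i)
(`norm_fst_le_of_mem_H10`) is obtained by integrating φ² by parts against a centred linear weight
and passing to the closure. The Gårding inequality b(u,u) ≥ ½‖∇u‖² − C₀²‖u‖² (`bForm_self_ge`)
follows from ellipticity and from Young's inequality applied to the advection term. If H C₀ < ½,
then C₀‖u‖ ≤ ½‖∇u‖, so b(u,u) ≥ ¼‖∇u‖². Hence b(u,u) = 0 gives ∇u = 0, and by Poincaré u = 0.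

Part (b) is the case C₀ = 0 of part (a), where the smallness condition holds for every H. -/

namespace Schwarz

/-! ### Poincaré inequality on H¹₀ with the diameter as constant -/

section Poincare

variable {d : ℕ} {Ω : Set (Space d)}

lemma IsTestFunction.add {φ ψ : Space d → ℝ} (hφ : IsTestFunction Ω φ)
    (hψ : IsTestFunction Ω ψ) : IsTestFunction Ω (fun x => φ x + ψ x) where
  smooth := hφ.smooth.add hψ.smooth
  compactSupport := hφ.compactSupport.add hψ.compactSupport
  support_subset := (tsupport_add φ ψ).trans (Set.union_subset hφ.support_subset hψ.support_subset)

lemma IsTestFunction.const_mul {φ : Space d → ℝ} (hφ : IsTestFunction Ω φ) (r : ℝ) :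
    IsTestFunction Ω (fun x => r * φ x) where
  smooth := contDiff_const.mul hφ.smooth
  compactSupport := hφ.compactSupport.mul_left
  support_subset := (tsupport_mul_subset_right (f := fun _ => r) (g := φ)).trans hφ.support_subset

lemma isTestFunction_zero : IsTestFunction Ω (fun _ => (0 : ℝ)) where
  smooth := contDiff_const
  compactSupport := HasCompactSupport.zero
  support_subset := by simp [tsupport]

/-- The pairs `(φ, ∇φ)` of test functions already form a subspace. -/
lemma mem_testPairs_of_mem_span {p : SobolevPair Ω}
    (hp : p ∈ Submodule.span ℝ (testPairs Ω)) : p ∈ testPairs Ω := by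
  induction hp using Submodule.span_induction with
  | mem p hp => exact hp
  | zero =>
    refine ⟨fun _ => 0, isTestFunction_zero, Lp.coeFn_zero ℝ 2 _, ?_⟩
    filter_upwards [Lp.coeFn_zero (Space d) 2 (volume.restrict Ω)] with x hx
    rw [Prod.snd_zero, hx]
    simp [gradient]
  | add p q _ _ ihp ihq =>
    obtain ⟨φ, hφ, hp1, hp2⟩ := ihp
    obtain ⟨ψ, hψ, hq1, hq2⟩ := ihq
    refine ⟨_, hφ.add hψ, ?_, ?_⟩
    · filter_upwards [Lp.coeFn_add p.1 q.1, hp1, hq1] with x hx h1 h2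
      rw [Prod.fst_add, hx, Pi.add_apply, h1, h2]
    · filter_upwards [Lp.coeFn_add p.2 q.2, hp2, hq2] with x hx h1 h2
      rw [Prod.snd_add, hx, Pi.add_apply, h1, h2, gradient, gradient, gradient,
        fderiv_fun_add (hφ.smooth.differentiable (by simp) x)
          (hψ.smooth.differentiable (by simp) x), map_add]
  | smul r p _ ih =>
    obtain ⟨φ, hφ, hp1, hp2⟩ := ih
    refine ⟨_, hφ.const_mul r, ?_, ?_⟩
    · filter_upwards [Lp.coeFn_smul r p.1, hp1] with x hx h1
      rw [Prod.smul_fst, hx, Pi.smul_apply, h1, smul_eq_mul]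
    · filter_upwards [Lp.coeFn_smul r p.2, hp2] with x hx h1
      rw [Prod.smul_snd, hx, Pi.smul_apply, h1, gradient, gradient,
        fderiv_const_mul (hφ.smooth.differentiable (by simp) x), map_smul]

/-- A bounded set lies in a strip, orthogonal to a given coordinate axis, of half-width half the
diameter. -/
lemma exists_abs_coord_sub_le (hb : Bornology.IsBounded Ω) (k : Fin d) :
    ∃ a : ℝ, ∀ x ∈ Ω, |x k - a| ≤ Metric.diam Ω / 2 := by
  rcases Ω.eq_empty_or_nonempty with rfl | hne
  · exact ⟨0, by simp⟩
  set S : Set ℝ := (fun x : Space d => x k) '' Ω with hS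
  have hdist : ∀ x ∈ Ω, ∀ y ∈ Ω, x k - y k ≤ Metric.diam Ω := fun x hx y hy => by
    refine le_trans ?_ (Metric.dist_le_diam_of_mem hb hx hy)
    rw [dist_eq_norm]
    refine (le_abs_self _).trans ?_
    simpa using PiLp.norm_apply_le (x - y) k
  have hSne : S.Nonempty := hne.image _
  obtain ⟨x₀, hx₀⟩ := hne
  have hab : BddAbove S := ⟨x₀ k + Metric.diam Ω, by
    rintro _ ⟨x, hx, rfl⟩; linarith [hdist x hx x₀ hx₀]⟩
  have hbe : BddBelow S := ⟨x₀ k - Metric.diam Ω, by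
    rintro _ ⟨x, hx, rfl⟩; linarith [hdist x₀ hx₀ x hx]⟩
  -- The projection of the set onto the axis has length at most the diameter, because a difference
  -- of coordinates is at most the distance.
  have hlen : sSup S ≤ sInf S + Metric.diam Ω := by
    refine csSup_le hSne ?_
    rintro _ ⟨x, hx, rfl⟩
    have : x k - Metric.diam Ω ≤ sInf S := by
      refine le_csInf hSne ?_
      rintro _ ⟨y, hy, rfl⟩
      linarith [hdist x hx y hy]
    linarith
  -- Centring at the midpoint of the projection gives half the diameter; this cancels the factor 2
  -- from differentiating φ² below.
  refine ⟨(sSup S + sInf S) / 2, fun x hx => ?_⟩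
  have h1 : x k ≤ sSup S := le_csSup hab ⟨x, hx, rfl⟩
  have h2 : sInf S ≤ x k := csInf_le hbe ⟨x, hx, rfl⟩
  rw [abs_le]
  constructor <;> linarith

/-- Integration by parts against the linear weight `x_k - a`. -/
lemma IsTestFunction.integral_sq_eq {φ : Space d → ℝ} (hφ : IsTestFunction Ω φ) (k : Fin d)
    (a : ℝ) : ∫ x, φ x ^ 2
      = - ∫ x, 2 * ((x k - a) * φ x * fderiv ℝ φ x (EuclideanSpace.single k 1)) := by
  set e : Space d := EuclideanSpace.single k 1 with he
  have hc : Continuous φ := hφ.smooth.continuous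
  have hfd : Continuous (fun x => fderiv ℝ φ x e) :=
    (hφ.smooth.continuous_fderiv (by simp)).clm_apply continuous_const
  have hk : Continuous (fun x : Space d => x k - a) := by fun_prop
  have hd : ∀ x, HasFDerivAt φ (fderiv ℝ φ x) x := fun x =>
    (hφ.smooth.differentiable (by simp) x).hasFDerivAt
  have hdk : ∀ x : Space d, HasFDerivAt (fun x : Space d => x k - a)
      (EuclideanSpace.proj k : Space d →L[ℝ] ℝ) x := fun x =>
    (EuclideanSpace.proj k : Space d →L[ℝ] ℝ).hasFDerivAt.sub_const a
  have hdsq : ∀ x, HasFDerivAt (fun x => φ x * φ x) (φ x • fderiv ℝ φ x + φ x • fderiv ℝ φ x) x :=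
    fun x => (hd x).mul (hd x)
  -- The weight x_k - a has derivative 1 in direction e, so moving the derivative from φ² to the
  -- weight leaves ∫ φ².
  have key := integral_mul_fderiv_eq_neg_fderiv_mul_of_integrable (μ := volume) (v := e)
    (f := fun x : Space d => x k - a) (g := fun x => φ x * φ x) ?_ ?_ ?_
    (fun x _ => (hdk x).differentiableAt) (fun x _ => (hdsq x).differentiableAt)
  · simp only [(hdk _).fderiv, (hdsq _).fderiv] at key
    have e1 : ∫ x, φ x ^ 2 = ∫ x, (EuclideanSpace.proj k : Space d →L[ℝ] ℝ) e * (φ x * φ x) := by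
      congr 1; ext x; simp [he, sq]
    rw [e1, ← neg_eq_iff_eq_neg, ← key]
    congr 1; ext x
    simp only [add_apply, smul_apply, smul_eq_mul]
    ring
  · simp only [(hdk _).fderiv]
    exact (continuous_const.mul (hc.mul hc)).integrable_of_hasCompactSupport
      (hφ.compactSupport.mul_right.mul_left)
  · simp only [(hdsq _).fderiv, add_apply, smul_apply, smul_eq_mul]
    refine (hk.mul ((hc.mul hfd).add (hc.mul hfd))).integrable_of_hasCompactSupport ?_
    exact (hφ.compactSupport.mul_right.add hφ.compactSupport.mul_right).mul_left
  · exact (hk.mul (hc.mul hc)).integrable_of_hasCompactSupport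
      (hφ.compactSupport.mul_right.mul_left)

lemma ae_norm_le_eLpNorm_top {F : Type} [NormedAddCommGroup F] {μ : Measure (Space d)}
    {f : Space d → F} (hf : MemLp f ∞ μ) : ∀ᵐ x ∂μ, ‖f x‖ ≤ (eLpNorm f ∞ μ).toReal := by
  filter_upwards [ae_le_eLpNormEssSup (f := f) (μ := μ)] with x hx
  rw [← toReal_enorm]
  exact ENNReal.toReal_mono hf.2.ne (eLpNorm_exponent_top (f := f) ▸ hx)

lemma integral_norm_sq_L2 {F : Type} [NormedAddCommGroup F] [InnerProductSpace ℝ F]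
    (f : L2 Ω F) : ∫ x in Ω, ‖f x‖ ^ 2 = ‖f‖ ^ 2 := by
  rw [← real_inner_self_eq_norm_sq, L2.inner_def]
  simp only [real_inner_self_eq_norm_sq]

lemma integrable_norm_sq_L2 {F : Type} [NormedAddCommGroup F] (f : L2 Ω F) :
    Integrable (fun x => ‖f x‖ ^ 2) (volume.restrict Ω) :=
  (Lp.memLp f).norm.integrable_sq

lemma IsTestFunction.integrable_coord_mul {φ : Space d → ℝ} (hφ : IsTestFunction Ω φ) (k : Fin d)
    (a : ℝ) : Integrable
      (fun x => 2 * ((x k - a) * φ x * fderiv ℝ φ x (EuclideanSpace.single k 1))) := by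
  have hc : Continuous φ := hφ.smooth.continuous
  have hfd : Continuous (fun x => fderiv ℝ φ x (EuclideanSpace.single k 1)) :=
    (hφ.smooth.continuous_fderiv (by simp)).clm_apply continuous_const
  have hk : Continuous (fun x : Space d => x k - a) := by fun_prop
  exact (continuous_const.mul ((hk.mul hc).mul hfd)).integrable_of_hasCompactSupport
    (HasCompactSupport.mul_left hφ.compactSupport.mul_left.mul_right)

/-- The Cauchy–Schwarz inequality for the pointwise norms of two square-integrable functions. -/
lemma integral_norm_mul_norm_le {F G : Type} [NormedAddCommGroup F] [NormedAddCommGroup G]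
    (f : L2 Ω F) (g : L2 Ω G) : ∫ x in Ω, ‖f x‖ * ‖g x‖ ≤ ‖f‖ * ‖g‖ := by
  have hf := (Lp.memLp f).norm
  have hg := (Lp.memLp g).norm
  have h := real_inner_le_norm (hf.toLp _) (hg.toLp _)
  rw [Lp.norm_toLp, Lp.norm_toLp, eLpNorm_norm, eLpNorm_norm, ← Lp.norm_def, ← Lp.norm_def,
    L2.inner_def] at h
  refine le_trans (le_of_eq (integral_congr_ae ?_)) h
  filter_upwards [hf.coeFn_toLp, hg.coeFn_toLp] with x h1 h2
  rw [h1, h2]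
  simp [mul_comm]

/-- Poincaré inequality for test functions. -/
lemma norm_fst_le_of_mem_testPairs (hd : 1 ≤ d) (hb : Bornology.IsBounded Ω)
    {p : SobolevPair Ω} (hp : p ∈ testPairs Ω) : ‖p.1‖ ≤ Metric.diam Ω * ‖p.2‖ := by
  obtain ⟨φ, hφ, h1, h2⟩ := hp
  -- Any axis would do; `hd` provides one. For d = 0 the inequality fails on a one-point set.
  set k : Fin d := ⟨0, hd⟩
  obtain ⟨a, ha⟩ := exists_abs_coord_sub_le hb k
  set D := Metric.diam Ω
  have hD : 0 ≤ D := Metric.diam_nonneg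
  have hout : ∀ x ∉ Ω, φ x = 0 := fun x hx =>
    image_eq_zero_of_notMem_tsupport fun hx' => hx (hφ.support_subset hx')
  have hsq : ∫ x in Ω, φ x ^ 2 = ∫ x, φ x ^ 2 :=
    setIntegral_eq_integral_of_forall_compl_eq_zero fun x hx => by simp [hout x hx]
  -- Inside Ω the weight is at most D / 2 in absolute value; outside, both sides vanish with φ.
  have hpw : ∀ x, -(2 * ((x k - a) * φ x * fderiv ℝ φ x (EuclideanSpace.single k 1)))
      ≤ D * (|φ x| * ‖gradient φ x‖) := fun x => by
    by_cases hx : x ∈ Ω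
    · have hder : |fderiv ℝ φ x (EuclideanSpace.single k 1)| ≤ ‖gradient φ x‖ := by
        rw [← inner_gradient_eq]
        refine (abs_real_inner_le_norm _ _).trans ?_
        simp
      refine (neg_le_abs _).trans ?_
      rw [abs_mul, abs_mul, abs_mul, abs_two]
      calc 2 * (|x k - a| * |φ x| * |fderiv ℝ φ x (EuclideanSpace.single k 1)|)
          ≤ 2 * (D / 2 * |φ x| * ‖gradient φ x‖) := by gcongr; exact ha x hx
        _ = _ := by ring
    · simp [hout x hx]
  have hint : Integrable (fun x => |φ x| * ‖gradient φ x‖) := by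
    refine (hφ.smooth.continuous.abs.mul hφ.continuous_gradient.norm).integrable_of_hasCompactSupport
      ?_
    exact HasCompactSupport.mul_right hφ.compactSupport.norm
  have hmain : ‖p.1‖ ^ 2 ≤ D * (‖p.1‖ * ‖p.2‖) := by
    rw [← integral_norm_sq_L2]
    calc ∫ x in Ω, ‖p.1 x‖ ^ 2 = ∫ x in Ω, φ x ^ 2 :=
          integral_congr_ae (h1.mono fun x hx => by simp only [hx, Real.norm_eq_abs, sq_abs])
      _ = ∫ x, -(2 * ((x k - a) * φ x * fderiv ℝ φ x (EuclideanSpace.single k 1))) := by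
          rw [hsq, hφ.integral_sq_eq k a, integral_neg]
      _ ≤ ∫ x, D * (|φ x| * ‖gradient φ x‖) := by
          refine integral_mono ?_ (hint.const_mul D) hpw
          exact (hφ.integrable_coord_mul k a).neg
      _ = D * ∫ x in Ω, |φ x| * ‖gradient φ x‖ := by
          rw [integral_const_mul, setIntegral_eq_integral_of_forall_compl_eq_zero]
          intro x hx
          simp [hout x hx]
      _ = D * ∫ x in Ω, ‖p.1 x‖ * ‖p.2 x‖ := by
          congr 1
          refine integral_congr_ae ?_
          filter_upwards [h1, h2] with x hx1 hx2
          rw [hx1, hx2, Real.norm_eq_abs]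
      _ ≤ D * (‖p.1‖ * ‖p.2‖) := by
          gcongr
          exact integral_norm_mul_norm_le p.1 p.2
  -- The estimate ‖u‖² ≤ D ‖u‖ ‖∇u‖ is divided by ‖u‖, with ‖u‖ = 0 treated separately.
  rcases (norm_nonneg p.1).eq_or_lt with h0 | h0
  · rw [← h0]; positivity
  · refine le_of_mul_le_mul_left ?_ h0
    linarith

/-- Poincaré inequality on `H¹₀(Ω)`, with the diameter as constant. -/
lemma norm_fst_le_of_mem_H10 (hd : 1 ≤ d) (hb : Bornology.IsBounded Ω)
    {p : SobolevPair Ω} (hp : p ∈ H10 Ω) : ‖p.1‖ ≤ Metric.diam Ω * ‖p.2‖ := by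
  have hcl : IsClosed {p : SobolevPair Ω | ‖p.1‖ ≤ Metric.diam Ω * ‖p.2‖} :=
    isClosed_le continuous_fst.norm (continuous_const.mul continuous_snd.norm)
  -- Both sides are continuous in the pair, so the inequality survives the closure that defines H¹₀.
  exact closure_minimal (fun q hq =>
    norm_fst_le_of_mem_testPairs hd hb (mem_testPairs_of_mem_span hq)) hcl hp

end Poincare

/-! ### Coefficients and the bilinear form -/

section Form

variable {d : ℕ} {Ω Ω' : Set (Space d)} {A : Space d → Matrix (Fin d) (Fin d) ℝ}
  {β : Space d → Space d} {c cplus : Space d → ℝ} {amax : ℝ}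

/-- Measurability and boundedness of the coefficients, with ellipticity constant one. -/
structure AdmissibleCoefficients (Ω : Set (Space d)) (A : Space d → Matrix (Fin d) (Fin d) ℝ)
    (β : Space d → Space d) (c : Space d → ℝ) (amax : ℝ) : Prop where
  aemeasurable : ∀ k l, AEMeasurable (fun x => A x k l) (volume.restrict Ω)
  symm : ∀ᵐ x ∂(volume.restrict Ω), (A x).IsSymm
  elliptic : ∀ᵐ x ∂(volume.restrict Ω), ∀ ξ : Space d,
    ‖ξ‖ ^ 2 ≤ ⟪(A x).toEuclideanLin ξ, ξ⟫_ℝ ∧ ⟪(A x).toEuclideanLin ξ, ξ⟫_ℝ ≤ amax * ‖ξ‖ ^ 2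
  advection : MemLp β ∞ (volume.restrict Ω)
  reaction : MemLp c ∞ (volume.restrict Ω)

lemma AdmissibleCoefficients.mono (h : Ω' ⊆ Ω) (hC : AdmissibleCoefficients Ω A β c amax) :
    AdmissibleCoefficients Ω' A β c amax where
  aemeasurable k l := (hC.aemeasurable k l).mono_measure (Measure.restrict_mono_set volume h)
  symm := ae_mono (Measure.restrict_mono_set volume h) hC.symm
  elliptic := ae_mono (Measure.restrict_mono_set volume h) hC.elliptic
  advection := hC.advection.mono_measure (Measure.restrict_mono_set volume h)
  reaction := hC.reaction.mono_measure (Measure.restrict_mono_set volume h)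

/-- A symmetric matrix whose quadratic form lies between `0` and `a |ξ|²` has a bounded bilinear
form. -/
lemma abs_inner_toEuclideanLin_le {M : Matrix (Fin d) (Fin d) ℝ} (hM : M.IsSymm) {a : ℝ}
    (h : ∀ ξ : Space d, 0 ≤ ⟪M.toEuclideanLin ξ, ξ⟫_ℝ ∧ ⟪M.toEuclideanLin ξ, ξ⟫_ℝ ≤ a * ‖ξ‖ ^ 2)
    (ξ η : Space d) : |⟪M.toEuclideanLin ξ, η⟫_ℝ| ≤ a * (‖ξ‖ ^ 2 + ‖η‖ ^ 2) := by
  have hs : M.toEuclideanLin.IsSymmetric := by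
    rw [Matrix.isSymmetric_toEuclideanLin_iff, Matrix.IsHermitian,
      Matrix.conjTranspose_eq_transpose_of_trivial]
    exact hM
  have hsym : ⟪M.toEuclideanLin η, ξ⟫_ℝ = ⟪M.toEuclideanLin ξ, η⟫_ℝ := by
    rw [hs η ξ, real_inner_comm]
  -- With q the quadratic form of M, q(ξ ± η) ≥ 0 gives 2|⟪Mξ, η⟫| ≤ q(ξ) + q(η), and the upper
  -- bound on q finishes.
  have h1 := h (ξ + η)
  have h2 := h (ξ - η)
  have e1 : ⟪M.toEuclideanLin (ξ + η), ξ + η⟫_ℝ = ⟪M.toEuclideanLin ξ, ξ⟫_ℝ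
      + 2 * ⟪M.toEuclideanLin ξ, η⟫_ℝ + ⟪M.toEuclideanLin η, η⟫_ℝ := by
    rw [map_add, inner_add_left, inner_add_right, inner_add_right, hsym]; ring
  have e2 : ⟪M.toEuclideanLin (ξ - η), ξ - η⟫_ℝ = ⟪M.toEuclideanLin ξ, ξ⟫_ℝ
      - 2 * ⟪M.toEuclideanLin ξ, η⟫_ℝ + ⟪M.toEuclideanLin η, η⟫_ℝ := by
    rw [map_sub, inner_sub_left, inner_sub_right, inner_sub_right, hsym]; ring
  rw [e1] at h1
  rw [e2] at h2
  have h3 := h ξ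
  have h4 := h η
  rw [abs_le]
  constructor <;> nlinarith

lemma integrable_diffusion (hC : AdmissibleCoefficients Ω A β c amax) (f g : L2 Ω (Space d)) :
    Integrable (fun x => ⟪(A x).toEuclideanLin (f x), g x⟫_ℝ) (volume.restrict Ω) := by
  refine Integrable.mono' (g := fun x => amax * (‖f x‖ ^ 2 + ‖g x‖ ^ 2))
    (((integrable_norm_sq_L2 f).add (integrable_norm_sq_L2 g)).const_mul amax) ?_ ?_
  · have hf : ∀ k, AEMeasurable (fun x => f x k) (volume.restrict Ω) := fun k =>
      ((EuclideanSpace.proj k : Space d →L[ℝ] ℝ).continuous.measurable.comp_aemeasurable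
        (Lp.aestronglyMeasurable f).aemeasurable)
    have hg : ∀ k, AEMeasurable (fun x => g x k) (volume.restrict Ω) := fun k =>
      ((EuclideanSpace.proj k : Space d →L[ℝ] ℝ).continuous.measurable.comp_aemeasurable
        (Lp.aestronglyMeasurable g).aemeasurable)
    -- Only the entries of A are known to be measurable, so the inner product is expanded in
    -- coordinates.
    have e : (fun x => ⟪(A x).toEuclideanLin (f x), g x⟫_ℝ)
        = fun x => ∑ k, g x k * ∑ l, A x k l * f x l := by
      ext x
      simp [PiLp.inner_apply, Matrix.toLpLin_apply, Matrix.mulVec, dotProduct]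
    rw [e]
    refine (Finset.aemeasurable_fun_sum _ fun k _ => (hg k).mul ?_).aestronglyMeasurable
    exact Finset.aemeasurable_fun_sum _ fun l _ => (hC.aemeasurable k l).mul (hf l)
  · filter_upwards [hC.symm, hC.elliptic] with x hs he
    exact abs_inner_toEuclideanLin_le hs
      (fun ξ => ⟨(sq_nonneg _).trans (he ξ).1, (he ξ).2⟩) _ _

lemma integrable_advection (hC : AdmissibleCoefficients Ω A β c amax) (f : L2 Ω (Space d))
    (v : L2 Ω ℝ) : Integrable (fun x => ⟪β x, f x⟫_ℝ * v x) (volume.restrict Ω) := by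
  have h1 : Integrable (fun x => v x • f x) (volume.restrict Ω) :=
    integrable_smul_of_L2 (Lp.memLp v) (Lp.memLp f)
  refine (h1.norm.const_mul (eLpNorm β ∞ (volume.restrict Ω)).toReal).mono' ?_ ?_
  · exact (hC.advection.aestronglyMeasurable.inner (Lp.aestronglyMeasurable f)).mul
      (Lp.aestronglyMeasurable v)
  · filter_upwards [ae_norm_le_eLpNorm_top hC.advection] with x hx
    rw [norm_mul, norm_smul, mul_comm ‖v x‖, ← mul_assoc]
    gcongr
    exact (norm_inner_le_norm _ _).trans (by gcongr)

lemma integrable_reaction (hC : AdmissibleCoefficients Ω A β c amax) (u v : L2 Ω ℝ) :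
    Integrable (fun x => c x * u x * v x) (volume.restrict Ω) := by
  have h1 : Integrable (fun x => u x • v x) (volume.restrict Ω) :=
    integrable_smul_of_L2 (Lp.memLp u) (Lp.memLp v)
  refine (h1.norm.const_mul (eLpNorm c ∞ (volume.restrict Ω)).toReal).mono' ?_ ?_
  · exact (hC.reaction.aestronglyMeasurable.mul (Lp.aestronglyMeasurable u)).mul
      (Lp.aestronglyMeasurable v)
  · filter_upwards [ae_norm_le_eLpNorm_top hC.reaction] with x hx
    rw [mul_assoc, norm_mul, smul_eq_mul]
    gcongr

lemma integrable_bForm (hC : AdmissibleCoefficients Ω A β c amax) (u v : SobolevPair Ω) :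
    Integrable (fun x => ⟪(A x).toEuclideanLin (u.2 x), v.2 x⟫_ℝ + ⟪β x, u.2 x⟫_ℝ * v.1 x
      + c x * u.1 x * v.1 x) (volume.restrict Ω) :=
  ((integrable_diffusion hC u.2 v.2).add (integrable_advection hC u.2 v.1)).add
    (integrable_reaction hC u.1 v.1)

/-- The form `bForm` as a bilinear map. -/
noncomputable def bilinearForm (hC : AdmissibleCoefficients Ω A β c amax) :
    SobolevPair Ω →ₗ[ℝ] SobolevPair Ω →ₗ[ℝ] ℝ :=
  LinearMap.mk₂ ℝ (bForm Ω A β c)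
    (fun u u' v => by
      rw [bForm, bForm, bForm, ← integral_add (integrable_bForm hC u v) (integrable_bForm hC u' v)]
      refine integral_congr_ae ?_
      filter_upwards [Lp.coeFn_add u.1 u'.1, Lp.coeFn_add u.2 u'.2] with x h1 h2
      rw [Prod.fst_add, Prod.snd_add, h1, h2, Pi.add_apply, Pi.add_apply, map_add, inner_add_left,
        inner_add_right]
      ring)
    (fun r u v => by
      rw [bForm, bForm, smul_eq_mul, ← integral_const_mul]
      refine integral_congr_ae ?_
      filter_upwards [Lp.coeFn_smul r u.1, Lp.coeFn_smul r u.2] with x h1 h2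
      rw [Prod.smul_fst, Prod.smul_snd, h1, h2, Pi.smul_apply, Pi.smul_apply, map_smul,
        real_inner_smul_left, real_inner_smul_right, smul_eq_mul]
      ring)
    (fun u v v' => by
      rw [bForm, bForm, bForm, ← integral_add (integrable_bForm hC u v) (integrable_bForm hC u v')]
      refine integral_congr_ae ?_
      filter_upwards [Lp.coeFn_add v.1 v'.1, Lp.coeFn_add v.2 v'.2] with x h1 h2
      rw [Prod.fst_add, Prod.snd_add, h1, h2, Pi.add_apply, Pi.add_apply, inner_add_right]
      ring)
    (fun r u v => by
      rw [bForm, bForm, smul_eq_mul, ← integral_const_mul]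
      refine integral_congr_ae ?_
      filter_upwards [Lp.coeFn_smul r v.1, Lp.coeFn_smul r v.2] with x h1 h2
      rw [Prod.smul_fst, Prod.smul_snd, h1, h2, Pi.smul_apply, Pi.smul_apply,
        real_inner_smul_right, smul_eq_mul]
      ring)

/-! ### Gårding inequality and definiteness -/

lemma ae_cMinusInf_le (hc : MemLp c ∞ (volume.restrict Ω))
    (hcplus : MemLp cplus ∞ (volume.restrict Ω)) :
    ∀ᵐ x ∂(volume.restrict Ω), cMinusInf Ω c cplus ≤ c x - cplus x := by
  refine ae_essInf_le (f := fun x => c x - cplus x) ?_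
  -- In ℝ the essential infimum is an a.e. lower bound only once some essential lower bound exists;
  -- here it is -‖c⁻‖_∞.
  refine ⟨-(eLpNorm (c - cplus) ∞ (volume.restrict Ω)).toReal, ?_⟩
  rw [Filter.eventually_map]
  filter_upwards [ae_norm_le_eLpNorm_top (hc.sub hcplus)] with x hx
  exact neg_le_of_abs_le hx

/-- Gårding inequality for the form of a subdomain, with the constant `C₀` of the whole domain. -/
lemma bForm_self_ge (h : Ω' ⊆ Ω) (hC : AdmissibleCoefficients Ω A β c amax)
    (hcplus : MemLp cplus ∞ (volume.restrict Ω))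
    (hcplus_nonneg : ∀ᵐ x ∂(volume.restrict Ω), 0 ≤ cplus x) (u : SobolevPair Ω') :
    1 / 2 * ‖u.2‖ ^ 2 - C0 Ω β c cplus ^ 2 * ‖u.1‖ ^ 2 ≤ bForm Ω' A β c u u := by
  rw [← integral_norm_sq_L2, ← integral_norm_sq_L2, ← integral_const_mul, ← integral_const_mul,
    ← integral_sub ((integrable_norm_sq_L2 u.2).const_mul _)
      ((integrable_norm_sq_L2 u.1).const_mul _)]
  refine integral_mono_ae (((integrable_norm_sq_L2 u.2).const_mul _).sub
      ((integrable_norm_sq_L2 u.1).const_mul _)) (integrable_bForm (hC.mono h) u u) ?_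
  -- Bounds valid a.e. on Ω hold a.e. on Ω', so C₀ of the whole domain serves every subdomain.
  refine ae_mono (Measure.restrict_mono_set volume h) ?_
  filter_upwards [hC.elliptic, ae_norm_le_eLpNorm_top hC.advection, hcplus_nonneg,
    ae_cMinusInf_le hC.reaction hcplus] with x hA hβ hp hm
  change ‖β x‖ ≤ supNorm Ω β at hβ
  set m := max (-cMinusInf Ω c cplus) 0 with hm_def
  have hC0 : C0 Ω β c cplus ^ 2 = 1 / 2 * supNorm Ω β ^ 2 + m :=
    Real.sq_sqrt (by positivity)
  have hmc : -m ≤ c x := by linarith [le_max_left (-cMinusInf Ω c cplus) 0]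
  have hadv : -(supNorm Ω β * ‖u.2 x‖ * |u.1 x|) ≤ ⟪β x, u.2 x⟫_ℝ * u.1 x := by
    refine neg_le_of_abs_le ?_
    rw [abs_mul]
    gcongr
    exact (abs_real_inner_le_norm _ _).trans (by gcongr)
  have hreact : -m * |u.1 x| ^ 2 ≤ c x * u.1 x * u.1 x := by
    rw [sq_abs, mul_assoc, ← sq]
    gcongr
  have hdiff := (hA (u.2 x)).1
  simp only [hC0, Real.norm_eq_abs]
  -- Young's inequality ‖β‖_∞ |∇u| |u| ≤ ½|∇u|² + ½‖β‖_∞²|u|²: the first term uses up half of the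
  -- ellipticity, the second is the advection part of C₀².
  nlinarith [sq_nonneg (‖u.2 x‖ - supNorm Ω β * |u.1 x|)]

/-- On a subdomain of small diameter the local form is definite on `H¹₀`. -/
lemma eq_zero_of_bForm_self_eq_zero (hd : 1 ≤ d) (hb : Bornology.IsBounded Ω) (h : Ω' ⊆ Ω)
    (hC : AdmissibleCoefficients Ω A β c amax) (hcplus : MemLp cplus ∞ (volume.restrict Ω))
    (hcplus_nonneg : ∀ᵐ x ∂(volume.restrict Ω), 0 ≤ cplus x)
    (hsmall : Metric.diam Ω' * C0 Ω β c cplus < 1 / 2) {u : SobolevPair Ω'} (hu : u ∈ H10 Ω')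
    (h0 : bForm Ω' A β c u u = 0) : u = 0 := by
  -- Boundedness matters: `Metric.diam` is 0 on sets of infinite diameter.
  have hP := norm_fst_le_of_mem_H10 hd (hb.subset h) hu
  have hG := bForm_self_ge h hC hcplus hcplus_nonneg u
  have hC0 : 0 ≤ C0 Ω β c cplus := Real.sqrt_nonneg _
  have h1 : C0 Ω β c cplus * ‖u.1‖ ≤ 1 / 2 * ‖u.2‖ :=
    calc C0 Ω β c cplus * ‖u.1‖ ≤ C0 Ω β c cplus * (Metric.diam Ω' * ‖u.2‖) := by gcongr
      _ = Metric.diam Ω' * C0 Ω β c cplus * ‖u.2‖ := by ring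
      _ ≤ 1 / 2 * ‖u.2‖ := by gcongr
  have h2 : (C0 Ω β c cplus * ‖u.1‖) ^ 2 ≤ (1 / 2 * ‖u.2‖) ^ 2 := by gcongr
  have h3 : ‖u.2‖ = 0 := by
    -- By `h2`, C₀²‖u‖² ≤ ¼‖∇u‖², so `hG` with b(u,u) = 0 leaves ¼‖∇u‖² ≤ 0.
    rw [← sq_eq_zero_iff]
    refine le_antisymm ?_ (sq_nonneg _)
    rw [h0] at hG
    nlinarith
  have h4 : ‖u.1‖ = 0 := le_antisymm (by simpa [h3] using hP) (norm_nonneg _)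
  exact Prod.ext (norm_eq_zero.1 h4) (norm_eq_zero.1 h3)

/-! ### Unique solvability of the local problems -/

/-- The local problems are uniquely solvable when the local form is definite. -/
lemma wellDefinedLocalSolve_of_definite (h : Ω' ⊆ Ω) (hm : MeasurableSet Ω')
    (hC : AdmissibleCoefficients Ω A β c amax) (Vh : Submodule ℝ (SobolevPair Ω))
    [FiniteDimensional ℝ Vh]
    (hdef : ∀ u ∈ H10 Ω', bForm Ω' A β c u u = 0 → u = 0) :
    WellDefinedLocalSolve h hm A β c Vh := by
  set V := localSpace h Vh with hV
  have : FiniteDimensional ℝ V :=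
    Submodule.finiteDimensional_of_le (S₂ := Vh.map (restrict h)) inf_le_left
  set B : V →ₗ[ℝ] Module.Dual ℝ V := (bilinearForm (hC.mono h)).domRestrict₁₂ V V with hB
  have hBapp : ∀ u v : V, B u v = bForm Ω' A β c u v := fun _ _ => rfl
  have hinj : Function.Injective B := by
    refine (injective_iff_map_eq_zero B).2 fun u hu => Subtype.ext (hdef u u.2.2 ?_)
    rw [← hBapp, hu, LinearMap.zero_apply]
  set E : V ≃ₗ[ℝ] Module.Dual ℝ V :=
    -- V and its dual have equal dimension, so injectivity alone gives solvability; no coercivity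
    -- constant is needed.
    LinearEquiv.ofInjectiveOfFinrankEq B hinj (Subspace.dual_finrank_eq).symm
  have hE : ∀ f, B (E.symm f) = f := fun f => E.apply_symm_apply f
  set R : SobolevPair Ω →ₗ[ℝ] Module.Dual ℝ V :=
    (bilinearForm hC).compl₂ ((zeroExt Ω hm).toLinearMap ∘ₗ V.subtype) with hR
  have hRapp : ∀ u (v : V), R u v = bForm Ω A β c u (zeroExt Ω hm v) := fun _ _ => rfl
  have hsol : ∀ u (v : V), bForm Ω' A β c (E.symm (R u)) v = bForm Ω A β c u (zeroExt Ω hm v) :=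
    fun u v => by rw [← hBapp, hE, hRapp]
  have huniq : ∀ u (w : V), (∀ v : V, bForm Ω' A β c w v = bForm Ω A β c u (zeroExt Ω hm v)) →
      w = E.symm (R u) := fun u w hw => hinj <| by
    rw [hE]
    exact LinearMap.ext fun v => hw v
  refine ⟨fun u _ => ⟨E.symm (R u), ⟨(E.symm (R u)).2, fun v hv => hsol u ⟨v, hv⟩⟩, ?_⟩,
    E.symm.toLinearMap ∘ₗ R ∘ₗ Vh.subtype, fun u v => hsol u v, ?_⟩
  · rintro w ⟨hwV, hw⟩
    exact congrArg Subtype.val (huniq u ⟨w, hwV⟩ fun v => hw v v.2)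
  · exact fun T hT => LinearMap.ext fun u => huniq u (T u) (hT u)

lemma C0_eq_zero (hcm : 0 ≤ cMinusInf Ω c cplus) (hβ : β =ᵐ[volume.restrict Ω] 0) :
    C0 Ω β c cplus = 0 := by
  have : supNorm Ω β = 0 := by
    rw [supNorm, eLpNorm_congr_ae hβ, eLpNorm_zero, ENNReal.toReal_zero]
  rw [C0, this, max_eq_right (neg_nonpos.2 hcm)]
  simp

end Form

end Schwarz

theorem mainTheorem6 {d : ℕ} (hd : 1 ≤ d)
    -- the domain
    (Ω : Set (Schwarz.Space d)) (hΩ : IsOpen Ω) (hΩb : Bornology.IsBounded Ω)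
    -- the coefficients
    (A : Schwarz.Space d → Matrix (Fin d) (Fin d) ℝ)
    (β : Schwarz.Space d → Schwarz.Space d) (c cplus : Schwarz.Space d → ℝ) (amax : ℝ)
    (hAmeas : ∀ k l, AEMeasurable (fun x => A x k l) (volume.restrict Ω))
    (hAsymm : ∀ᵐ x ∂(volume.restrict Ω), (A x).IsSymm)
    (hA : ∀ᵐ x ∂(volume.restrict Ω), ∀ ξ : Schwarz.Space d,
      ‖ξ‖ ^ 2 ≤ ⟪(A x).toEuclideanLin ξ, ξ⟫_ℝ ∧ ⟪(A x).toEuclideanLin ξ, ξ⟫_ℝ ≤ amax * ‖ξ‖ ^ 2)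
    (hβ : MemLp β ∞ (volume.restrict Ω))
    (hc : MemLp c ∞ (volume.restrict Ω))
    (hcplus : MemLp cplus ∞ (volume.restrict Ω))
    (hcplus_nonneg : ∀ᵐ x ∂(volume.restrict Ω), 0 ≤ cplus x)
    -- the conforming discrete space
    (Vh : Submodule ℝ (Schwarz.SobolevPair Ω)) (hVfin : FiniteDimensional ℝ Vh)
    (hVh : Vh ≤ Schwarz.H10 Ω)
    -- the subdomains
    (N : ℕ) (Ωs : Fin N → Set (Schwarz.Space d)) (hopen : ∀ i, IsOpen (Ωs i))
    (hsub : ∀ i, Ωs i ⊆ Ω) :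
    ((⨆ i, Metric.diam (Ωs i)) * Schwarz.C0 Ω β c cplus < 1 / 2 →
      ∀ i, Schwarz.WellDefinedLocalSolve (hsub i) (hopen i).measurableSet A β c Vh) ∧
    (0 ≤ Schwarz.cMinusInf Ω c cplus → β =ᵐ[volume.restrict Ω] 0 →
      ∀ i, Schwarz.WellDefinedLocalSolve (hsub i) (hopen i).measurableSet A β c Vh) := by
  have hC : Schwarz.AdmissibleCoefficients Ω A β c amax := ⟨hAmeas, hAsymm, hA, hβ, hc⟩
  have hmain : (⨆ i, Metric.diam (Ωs i)) * Schwarz.C0 Ω β c cplus < 1 / 2 →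
      ∀ i, Schwarz.WellDefinedLocalSolve (hsub i) (hopen i).measurableSet A β c Vh := by
    intro hH i
    refine Schwarz.wellDefinedLocalSolve_of_definite (hsub i) _ hC Vh fun u hu =>
      Schwarz.eq_zero_of_bForm_self_eq_zero hd hΩb (hsub i) hC hcplus hcplus_nonneg
        (lt_of_le_of_lt ?_ hH) hu
    -- A real supremum bounds its terms only when the family is bounded above, which finiteness of
    -- the index set ensures.
    exact mul_le_mul_of_nonneg_right
      (le_ciSup (f := fun j => Metric.diam (Ωs j)) (Set.finite_range _).bddAbove i)
      (Real.sqrt_nonneg _)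
  refine ⟨hmain, fun hcm hβ0 => hmain ?_⟩
  rw [Schwarz.C0_eq_zero hcm hβ0, mul_zero]
  norm_num
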